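/- **Proposition 1.2 (lower bounds for the random walk in random scenery).** Let $d\ge 3$, let $(S_k)_{k\ge 0}$ be the nearest-neighbour symmetric simple random walk on $\mathbb{Z}^d$ with $S_0=0$ (independent steps, uniform on the $2d$ unit vectors $\pm e_i$), and let $\{\eta(x),\,x\in\mathbb{Z}^d\}$ be i.i.d. real random variables, independent of the walk. Let $P$ denote the joint (averaged) law of the walk and the scenery, and set $$X_n=\sum_{k=0}^n \eta(S_k).$$ Assume that for some $\alpha>0$ and some $\kappa>0$ $$\lim_{t\to\infty}\frac{\log P(\eta(0)>t)}{t^{\alpha}}=-\kappa ,$$ and that the variables $\eta(x)$ are bell-shaped, i.e. their law has a density with respect to Lebesgue measure which is even and (weakly) decreasing on the positive half-line. Let $\beta\in\mathbb{R}$. Then: 1. (Region I) If $1/2<\beta\le 1$, then for every $y>0$ there is a constant $c_1>0$ such that for all integers $n\ge 1$ $$P(X_n\ge n^{\beta}y)\ \ge\ \exp\left(-c_1\,n^{2\beta-1}\right).$$ 2. (Region II) If $0\le\beta\le 1+1/\alpha$, then for every $y>0$ there is a constant $c_2>0$ such that for all integers $n\ge 1$ $$P(X_n\ge n^{\beta}y)\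 \ge\ \exp\left(-c_2\,n^{\beta\alpha/(\alpha+1)}\right).$$ 3. (Region III) If $0\le\beta\le 1$, then for every $y>0$ there is a constant $c_3>0$ such that for all integers $n\ge 1$ $$P(X_n\ge n^{\beta}y)\ \ge\ \exp\left(-c_3\,n^{\beta d/(d+2)}\right).$$ The constants $c_1,c_2,c_3$ do not depend on $n$; they may depend on $d$, the law of $\eta(0)$, $\beta$ and $y$. -/

import Mathlib

open MeasureTheory ProbabilityTheory Filter Topology

namespace RWRS

/-- The `2d` nearest neighbours `±eᵢ` of the origin in `ℤ^d`. -/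
def unitSteps (d : ℕ) : Set (Fin d → ℤ) :=
  {v | ∃ i : Fin d, v = Pi.single i 1 ∨ v = -Pi.single i 1}

/-- The law of one step of the nearest neighbour symmetric walk: uniform on `unitSteps d`. -/
noncomputable def stepLaw (d : ℕ) : Measure (Fin d → ℤ) :=
  uniformOn (unitSteps d)

theorem unitSteps_finite (d : ℕ) : (unitSteps d).Finite := by
  have h : unitSteps d ⊆ (Set.range fun i : Fin d => (Pi.single i 1 : Fin d → ℤ)) ∪
      (Set.range fun i : Fin d => (-Pi.single i 1 : Fin d → ℤ)) := by
    rintro v ⟨i, h | h⟩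
    · exact Or.inl ⟨i, h.symm⟩
    · exact Or.inr ⟨i, h.symm⟩
  exact ((Set.finite_range _).union (Set.finite_range _)).subset h

theorem isProbabilityMeasure_stepLaw {d : ℕ} (hd : 1 ≤ d) :
    IsProbabilityMeasure (stepLaw d) :=
  isProbabilityMeasure_uniformOn (unitSteps_finite d) ⟨_, ⟨⟨0, hd⟩, Or.inl rfl⟩⟩

/-- Sample space: a sequence of steps of the walk and a scenery on `ℤ^d`. -/
abbrev Sample (d : ℕ) : Type := (ℕ → Fin d → ℤ) × ((Fin d → ℤ) → ℝ)

/-- The averaged law `P = ℙ₀ ⊗ P_η`: i.i.d. steps with law `stepLaw d`, an i.i.d. scenery with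
marginal law `ν`, the walk and the scenery being independent. -/
noncomputable def prob (d : ℕ) (ν : Measure ℝ) : Measure (Sample d) :=
  (Measure.infinitePi fun _ : ℕ => stepLaw d).prod
    (Measure.infinitePi fun _ : Fin d → ℤ => ν)

/-- The walk `S_k`, started at `S_0 = 0`. -/
def walk {d : ℕ} (ω : Sample d) (k : ℕ) : Fin d → ℤ :=
  ∑ j ∈ Finset.range k, ω.1 j

/-- The random walk in random scenery `X_n = ∑_{k=0}^{n} η(S_k)`. -/
noncomputable def rwrs {d : ℕ} (ω : Sample d) (n : ℕ) : ℝ :=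
  ∑ k ∈ Finset.range (n + 1), ω.2 (walk ω k)

/-- A law on `ℝ` is bell-shaped if it has a density with respect to Lebesgue measure that is even
and (weakly) decreasing on the positive half-line. The value of the density at the single point
`0` is irrelevant and is left free. -/
def IsBellShaped (ν : Measure ℝ) : Prop :=
  ∃ f : ℝ → ℝ, Measurable f ∧ (∀ x, 0 ≤ f x) ∧ (∀ x, f (-x) = f x) ∧
    AntitoneOn f (Set.Ioi 0) ∧ ν = volume.withDensity fun x => ENNReal.ofReal (f x)

/-- The tail condition `lim_{t → ∞} t^{-α} log P(η > t) = -κ` for the law `ν` of `η`. -/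
def HasTailExponent (ν : Measure ℝ) (α κ : ℝ) : Prop :=
  Tendsto (fun t : ℝ => Real.log (ν.real (Set.Ioi t)) / t ^ α) atTop (𝓝 (-κ))

end RWRS

/-! Each bound comes from a strategy of the walk and the scenery whose cost is computed. For a fixed
path, $X_n=\sum_x \ell_n(x)\eta(x)$ with local times $\ell_n$ of total mass $n+1$. The scenery is
symmetric, so the sites outside a strategy contribute a nonnegative amount with probability at least
$1/2$ (`half_mul_measureReal_sum_le`).

Region I holds for every path. Either the visited sites split into about $n^{2\beta-1}$ groups, each
of Euclidean norm about $n^{1-\beta}$ and each of that size or more with probability bounded below,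
or so few sites carry half of the local time that all of them can be raised to a constant level
(`half_mul_pow_le_measureReal_sum`).

Region II: the walk oscillates between the origin and a neighbour for $m\approx n^\gamma$ steps, and
$\eta(0)\approx n^{\beta-\gamma}$. The costs $m$ and $n^{(\beta-\gamma)\alpha}$ balance at
$\gamma=\beta\alpha/(\alpha+1)$.

Region III: the walk stays in a cube of radius $R$ for $m\approx n^\beta$ steps, with the scenery at
least $y$ at the sites visited. The costs $m/R^2$ and $R^d$ balance at $R\approx n^{\beta/(d+2)}$.
-/

namespace RWRS

/-! ### Weighted sums of a symmetric i.i.d. scenery -/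

section Scenery

variable {ι : Type*} {ν : Measure ℝ} [IsProbabilityMeasure ν]

theorem measurePreserving_infinitePi_map {φ : ℝ → ℝ} (hφ : MeasurePreserving φ ν ν) :
    MeasurePreserving (fun (η : ι → ℝ) x => φ (η x))
      (Measure.infinitePi fun _ : ι => ν) (Measure.infinitePi fun _ : ι => ν) := by
  refine ⟨by have := hφ.measurable; fun_prop, ?_⟩
  rw [Measure.infinitePi_map_pi (μ := fun _ : ι => ν) (f := fun _ => φ) fun _ => hφ.measurable]
  simp_rw [hφ.map_eq]

theorem indepFun_weightedSum [DecidableEq ι] {f : ℝ → ℝ} (hf : Measurable f) (a b : ι → ℝ)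
    {S T : Finset ι} (hST : Disjoint S T) :
    IndepFun (fun η : ι → ℝ => ∑ x ∈ S, a x * f (η x)) (fun η => ∑ x ∈ T, b x * f (η x))
      (Measure.infinitePi fun _ : ι => ν) := by
  have h := iIndepFun_infinitePi (P := fun _ : ι => ν) (X := fun _ => f) fun _ => hf
  have h2 := h.indepFun_finset S T hST (fun i => by fun_prop)
  have h3 := h2.comp (φ := fun u : S → ℝ => ∑ x : S, a x * u x)
    (ψ := fun u : T → ℝ => ∑ x : T, b x * u x) (by fun_prop) (by fun_prop)
  convert h3 using 1
  · ext η
    exact (Finset.sum_coe_sort S fun x => a x * f (η x)).symm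
  · ext η
    exact (Finset.sum_coe_sort T fun x => b x * f (η x)).symm

theorem measureReal_sum_superposition [DecidableEq ι] (a : ι → ℝ) {S T : Finset ι}
    (hST : Disjoint S T) (s t : ℝ) :
    (Measure.infinitePi fun _ : ι => ν).real {η | s ≤ ∑ x ∈ S, a x * η x} *
      (Measure.infinitePi fun _ : ι => ν).real {η | t ≤ ∑ x ∈ T, a x * η x} ≤
      (Measure.infinitePi fun _ : ι => ν).real {η | s + t ≤ ∑ x ∈ S ∪ T, a x * η x} := by
  have h := indepFun_weightedSum (ν := ν) measurable_id a a hST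
  have h2 := h.measure_inter_preimage_eq_mul _ _ (measurableSet_Ici (a := s))
    (measurableSet_Ici (a := t))
  have h3 : (Measure.infinitePi fun _ : ι => ν).real {η | s ≤ ∑ x ∈ S, a x * η x} *
      (Measure.infinitePi fun _ : ι => ν).real {η | t ≤ ∑ x ∈ T, a x * η x} =
      (Measure.infinitePi fun _ : ι => ν).real
        ({η | s ≤ ∑ x ∈ S, a x * η x} ∩ {η | t ≤ ∑ x ∈ T, a x * η x}) := by
    simp only [measureReal_def, ← ENNReal.toReal_mul]
    exact congrArg ENNReal.toReal h2.symm
  rw [h3]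
  refine measureReal_mono fun η hη => ?_
  simp only [Set.mem_inter_iff, Set.mem_ofPred_eq] at hη ⊢
  rw [Finset.sum_union hST]
  exact add_le_add hη.1 hη.2

/-- Negating the scenery preserves its law, and either the sum or its negative is nonnegative. -/
theorem half_le_measureReal_sum_nonneg (hν : MeasurePreserving Neg.neg ν ν) (a : ι → ℝ)
    (S : Finset ι) :
    1 / 2 ≤ (Measure.infinitePi fun _ : ι => ν).real {η | 0 ≤ ∑ x ∈ S, a x * η x} := by
  have hm : MeasurableSet {η : ι → ℝ | 0 ≤ ∑ x ∈ S, a x * η x} :=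
    measurableSet_le measurable_const (by fun_prop)
  have h := (measurePreserving_infinitePi_map (ι := ι) hν).measureReal_preimage
    hm.nullMeasurableSet
  have h1 : (1 : ℝ) ≤ (Measure.infinitePi fun _ : ι => ν).real ({η | 0 ≤ ∑ x ∈ S, a x * η x} ∪
      ((fun (η : ι → ℝ) x => -(η x)) ⁻¹' {η | 0 ≤ ∑ x ∈ S, a x * η x})) := by
    rw [← probReal_univ (μ := Measure.infinitePi fun _ : ι => ν)]
    refine measureReal_mono fun η _ => ?_
    simp only [Set.mem_union, Set.mem_preimage, Set.mem_ofPred_eq, mul_neg, Finset.sum_neg_distrib]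
    rcases le_total 0 (∑ x ∈ S, a x * η x) with h | h
    · exact Or.inl h
    · exact Or.inr (by linarith)
  have h2 := h1.trans (measureReal_union_le _ _)
  rw [h] at h2
  linarith

theorem pow_card_le_measureReal_sum {a : ι → ℝ} (ha : ∀ x, 0 ≤ a x) (S : Finset ι) (t : ℝ) :
    ν.real (Set.Ici t) ^ S.card ≤
      (Measure.infinitePi fun _ : ι => ν).real {η | t * ∑ x ∈ S, a x ≤ ∑ x ∈ S, a x * η x} := by
  classical
  have h1 := Measure.infinitePi_pi (fun _ : ι => ν) (s := S) (t := fun _ => Set.Ici t)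
    fun _ _ => measurableSet_Ici
  have h2 : ν.real (Set.Ici t) ^ S.card =
      (Measure.infinitePi fun _ : ι => ν).real (Set.pi S fun _ => Set.Ici t) := by
    simp [measureReal_def, h1]
  rw [h2]
  refine measureReal_mono fun η hη => ?_
  simp only [Set.mem_ofPred_eq, Finset.mul_sum]
  refine Finset.sum_le_sum fun x hx => ?_
  rw [mul_comm]
  exact mul_le_mul_of_nonneg_left (hη x hx) (ha x)

/-- A level reached by the sum over some sites is reached by the sum over more sites, at the
cost of a factor two. -/
theorem half_mul_measureReal_sum_le (hν : MeasurePreserving Neg.neg ν ν) (a : ι → ℝ)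
    {S T : Finset ι} (hST : S ⊆ T) (s : ℝ) :
    1 / 2 * (Measure.infinitePi fun _ : ι => ν).real {η | s ≤ ∑ x ∈ S, a x * η x} ≤
      (Measure.infinitePi fun _ : ι => ν).real {η | s ≤ ∑ x ∈ T, a x * η x} := by
  classical
  have h := measureReal_sum_superposition (ν := ν) a
    (Finset.disjoint_sdiff (s := S) (t := T)) s 0
  rw [add_zero, Finset.union_sdiff_of_subset hST] at h
  refine le_trans ?_ h
  rw [mul_comm]
  exact mul_le_mul_of_nonneg_left (half_le_measureReal_sum_nonneg hν a _) measureReal_nonneg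

/-- Integrate $u-u^2/4\le 1_{u\ge 0}$ with $u=(Y^2-v/2)/(Cv)$; this scaling makes the left side at
least $1/(2C)-1/(4C)$ in mean. -/
theorem paley_zygmund_fourth {Ω : Type*} [MeasurableSpace Ω] {μ : Measure Ω}
    [IsProbabilityMeasure μ] {Y : Ω → ℝ} (hY : Measurable Y)
    (h2 : Integrable (fun ω => Y ω ^ 2) μ) (h4 : Integrable (fun ω => Y ω ^ 4) μ)
    {v C : ℝ} (hv : 0 < v) (hC : 0 < C) (hv2 : ∫ ω, Y ω ^ 2 ∂μ = v)
    (hv4 : ∫ ω, Y ω ^ 4 ∂μ ≤ C * v ^ 2) :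
    1 / (4 * C) ≤ μ.real {ω | v / 2 ≤ Y ω ^ 2} := by
  have hm : MeasurableSet {ω | v / 2 ≤ Y ω ^ 2} :=
    measurableSet_le measurable_const (by fun_prop)
  have hi : Integrable (fun ω => (1 / (C * v) + 1 / (4 * C ^ 2 * v)) * Y ω ^ 2
      - 1 / (4 * C ^ 2 * v ^ 2) * Y ω ^ 4) μ := (h2.const_mul _).sub (h4.const_mul _)
  have key : ∫ ω, ((1 / (C * v) + 1 / (4 * C ^ 2 * v)) * Y ω ^ 2
      - 1 / (4 * C ^ 2 * v ^ 2) * Y ω ^ 4 - (1 / (2 * C) + 1 / (16 * C ^ 2))) ∂μ ≤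
      ∫ ω, {ω | v / 2 ≤ Y ω ^ 2}.indicator (fun _ => (1 : ℝ)) ω ∂μ := by
    refine integral_mono (hi.sub (integrable_const _))
      ((integrable_const _).indicator hm) fun ω => ?_
    have e : (1 / (C * v) + 1 / (4 * C ^ 2 * v)) * Y ω ^ 2
      - 1 / (4 * C ^ 2 * v ^ 2) * Y ω ^ 4 - (1 / (2 * C) + 1 / (16 * C ^ 2)) =
      (Y ω ^ 2 - v / 2) / (C * v) - ((Y ω ^ 2 - v / 2) / (C * v)) ^ 2 / 4 := by
      field_simp
      ring
    simp only []
    rw [e]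
    by_cases hω : v / 2 ≤ Y ω ^ 2
    · rw [Set.indicator_of_mem (by exact hω)]
      nlinarith [sq_nonneg ((Y ω ^ 2 - v / 2) / (C * v) - 2)]
    · rw [Set.indicator_of_notMem (by exact hω)]
      have : (Y ω ^ 2 - v / 2) / (C * v) ≤ 0 :=
        div_nonpos_of_nonpos_of_nonneg (by linarith [not_le.mp hω]) (by positivity)
      nlinarith [sq_nonneg ((Y ω ^ 2 - v / 2) / (C * v))]
  rw [integral_indicator_const _ hm, integral_sub hi (integrable_const _), integral_sub (h2.const_mul _) (h4.const_mul _), integral_const_mul,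
    integral_const_mul, hv2, integral_const] at key
  simp only [probReal_univ, smul_eq_mul, mul_one] at key
  have h5 : 1 / (4 * C ^ 2 * v ^ 2) * ∫ ω, Y ω ^ 4 ∂μ ≤ 1 / (4 * C) := by
    calc _ ≤ 1 / (4 * C ^ 2 * v ^ 2) * (C * v ^ 2) := by gcongr
      _ = _ := by field_simp
  have h6 : (1 / (C * v) + 1 / (4 * C ^ 2 * v)) * v = 1 / C + 1 / (4 * C ^ 2) := by field_simp
  have h7 : 1 / (16 * C ^ 2) = 1 / (4 * C ^ 2) / 4 := by field_simp; norm_num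
  have h8 : 1 / C = 4 * (1 / (4 * C)) := by field_simp
  have h9 : 1 / (2 * C) = 2 * (1 / (4 * C)) := by field_simp; norm_num
  have h10 : 0 < 1 / (4 * C ^ 2) := by positivity
  rw [h6, h7, h8, h9] at key
  linarith

theorem integrable_pow_mul_pow {Ω : Type*} [MeasurableSpace Ω] {μ : Measure Ω}
    [IsFiniteMeasure μ] {Y Z : Ω → ℝ} (hY : Measurable Y) (hZ : Measurable Z) {A B : ℝ}
    (hA : ∀ ω, |Y ω| ≤ A) (hB : ∀ ω, |Z ω| ≤ B) (p q : ℕ) :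
    Integrable (fun ω => Y ω ^ p * Z ω ^ q) μ := by
  refine Integrable.of_bound (by fun_prop) (A ^ p * B ^ q) (ae_of_all _ fun ω => ?_)
  rw [Real.norm_eq_abs, abs_mul, abs_pow, abs_pow]
  have := hA ω
  have := hB ω
  have : 0 ≤ A := (abs_nonneg _).trans (hA ω)
  gcongr

omit [IsProbabilityMeasure ν] in
theorem integral_odd_eq_zero (hν : MeasurePreserving Neg.neg ν ν) {g : ℝ → ℝ}
    (hg : ∀ x, g (-x) = -g x) : ∫ x, g x ∂ν = 0 := by
  have h := hν.integral_comp (MeasurableEquiv.neg ℝ).measurableEmbedding g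
  simp only [hg, integral_neg] at h
  linarith

theorem abs_weightedSum_le {f : ℝ → ℝ} {K : ℝ} (hK : ∀ x, |f x| ≤ K) (a : ι → ℝ) (S : Finset ι)
    (η : ι → ℝ) : |∑ x ∈ S, a x * f (η x)| ≤ ∑ x ∈ S, |a x| * K := by
  refine (Finset.abs_sum_le_sum_abs _ _).trans (Finset.sum_le_sum fun x _ => ?_)
  rw [abs_mul]
  exact mul_le_mul_of_nonneg_left (hK _) (abs_nonneg _)

/-- Sites are added one at a time. Odd moments of the new term vanish, and the mixed term
$6\,E[Y^2]E[Z^2]$ fits into the cross term of $C(V+a_i^2)^2$ because $3m^2\le C$, with $m=\int f^2$.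
-/
theorem weightedSum_moments (hν : MeasurePreserving Neg.neg ν ν) {f : ℝ → ℝ} (hf : Measurable f)
    {K : ℝ} (hK : ∀ x, |f x| ≤ K) (hodd : ∀ x, f (-x) = -f x) (a : ι → ℝ) {C : ℝ}
    (hC2 : 3 * (∫ x, f x ^ 2 ∂ν) ^ 2 ≤ C) (hC4 : ∫ x, f x ^ 4 ∂ν ≤ C) (S : Finset ι) :
    (∫ η, (∑ x ∈ S, a x * f (η x)) ^ 2 ∂(Measure.infinitePi fun _ : ι => ν) =
      (∫ x, f x ^ 2 ∂ν) * ∑ x ∈ S, a x ^ 2) ∧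
    ∫ η, (∑ x ∈ S, a x * f (η x)) ^ 4 ∂(Measure.infinitePi fun _ : ι => ν) ≤
      C * (∑ x ∈ S, a x ^ 2) ^ 2 := by
  classical
  induction S using Finset.induction_on with
  | empty => simp
  | insert i S hi ih =>
    obtain ⟨ih2, ih4⟩ := ih
    set μ := Measure.infinitePi fun _ : ι => ν with hμ
    set Y : (ι → ℝ) → ℝ := fun η => ∑ x ∈ S, a x * f (η x) with hY
    set Z : (ι → ℝ) → ℝ := fun η => a i * f (η i) with hZ
    have mY : Measurable Y := by fun_prop
    have mZ : Measurable Z := by fun_prop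
    have hind : IndepFun Y Z μ := by
      have := indepFun_weightedSum (ν := ν) hf a a (Finset.disjoint_singleton_right.mpr hi)
      simpa only [Finset.sum_singleton] using this
    have bZ : ∀ η, |Z η| ≤ |a i| * K := fun η => by
      rw [hZ, abs_mul]
      exact mul_le_mul_of_nonneg_left (hK _) (abs_nonneg _)
    have I := fun p q => integrable_pow_mul_pow (μ := μ) mY mZ (abs_weightedSum_le hK a S) bZ p q
    have P : ∀ p q : ℕ, ∫ η, Y η ^ p * Z η ^ q ∂μ = (∫ η, Y η ^ p ∂μ) * ∫ η, Z η ^ q ∂μ :=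
      fun p q => (hind.comp (φ := fun u => u ^ p) (ψ := fun u => u ^ q) (by fun_prop)
        (by fun_prop)).integral_fun_mul_eq_mul_integral (by fun_prop) (by fun_prop)
    have Zq : ∀ q : ℕ, ∫ η, Z η ^ q ∂μ = a i ^ q * ∫ x, f x ^ q ∂ν := fun q => by
      have := (measurePreserving_eval_infinitePi (fun _ : ι => ν) i).hasLaw.integral_comp
        (f := fun x => (a i * f x) ^ q) (by fun_prop)
      rw [← integral_const_mul]
      simp_rw [← mul_pow]
      exact this
    have Z1 : ∫ η, Z η ^ 1 ∂μ = 0 := by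
      rw [Zq, integral_odd_eq_zero hν (fun x => by rw [hodd]; ring), mul_zero]
    have Z3 : ∫ η, Z η ^ 3 ∂μ = 0 := by
      rw [Zq, integral_odd_eq_zero hν (fun x => by rw [hodd]; ring), mul_zero]
    have e2 : ∀ η : ι → ℝ, (∑ x ∈ insert i S, a x * f (η x)) ^ 2 =
        Y η ^ 2 * Z η ^ 0 + 2 * (Y η ^ 1 * Z η ^ 1) + Y η ^ 0 * Z η ^ 2 := fun η => by
      rw [Finset.sum_insert hi]; simp only [hY, hZ]; ring
    have e4 : ∀ η : ι → ℝ, (∑ x ∈ insert i S, a x * f (η x)) ^ 4 =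
        Y η ^ 4 * Z η ^ 0 + 4 * (Y η ^ 3 * Z η ^ 1) + 6 * (Y η ^ 2 * Z η ^ 2) +
          4 * (Y η ^ 1 * Z η ^ 3) + Y η ^ 0 * Z η ^ 4 := fun η => by
      rw [Finset.sum_insert hi]; simp only [hY, hZ]; ring
    have V0 : 0 ≤ ∑ x ∈ S, a x ^ 2 := Finset.sum_nonneg fun x _ => sq_nonneg _
    rw [Finset.sum_insert hi]
    constructor
    · simp_rw [e2]
      rw [integral_add ((I 2 0).fun_add ((I 1 1).const_mul 2)) (I 0 2),
        integral_add (I 2 0) ((I 1 1).const_mul 2), integral_const_mul, P, P, P, Z1, Zq, Zq, ih2]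
      simp
      ring
    · simp_rw [e4]
      rw [integral_add ((((I 4 0).fun_add ((I 3 1).const_mul 4)).fun_add ((I 2 2).const_mul 6)).fun_add
          ((I 1 3).const_mul 4)) (I 0 4),
        integral_add (((I 4 0).fun_add ((I 3 1).const_mul 4)).fun_add ((I 2 2).const_mul 6))
          ((I 1 3).const_mul 4),
        integral_add ((I 4 0).fun_add ((I 3 1).const_mul 4)) ((I 2 2).const_mul 6),
        integral_add (I 4 0) ((I 3 1).const_mul 4), integral_const_mul, integral_const_mul,
        integral_const_mul, P, P, P, P, P, Z1, Z3, Zq, Zq, Zq, ih2]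
      simp only [pow_zero, integral_const, probReal_univ, one_smul, mul_one, mul_zero, add_zero,
        one_mul]
      have h1 := mul_le_mul_of_nonneg_left hC2
        (mul_nonneg (mul_nonneg (zero_le_two (α := ℝ)) V0) (sq_nonneg (a i)))
      have h2 := mul_le_mul_of_nonneg_left hC4 (by positivity : 0 ≤ a i ^ 4)
      nlinarith

end Scenery
-- Anticoncentration, uniformly in the weights
section Anticoncentration

variable {ι : Type*} {ν : Measure ℝ} [IsProbabilityMeasure ν]

/-- The map which reverses the sign of the numbers of absolute value larger than `K`. -/
noncomputable def outerNeg (K x : ℝ) : ℝ := if |x| ≤ K then x else -x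

/-- Truncation at level `K`. -/
noncomputable def truncate (K x : ℝ) : ℝ := if |x| ≤ K then x else 0

theorem measurable_outerNeg (K : ℝ) : Measurable (outerNeg K) :=
  Measurable.ite (measurableSet_le (by fun_prop) measurable_const) measurable_id measurable_neg

theorem measurable_truncate (K : ℝ) : Measurable (truncate K) :=
  Measurable.ite (measurableSet_le (by fun_prop) measurable_const) measurable_id measurable_const

theorem truncate_neg (K x : ℝ) : truncate K (-x) = -truncate K x := by
  unfold truncate
  rw [abs_neg]
  split_ifs <;> simp

theorem abs_truncate_le {K : ℝ} (hK : 0 ≤ K) (x : ℝ) : |truncate K x| ≤ K := by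
  unfold truncate
  split_ifs with h
  · exact h
  · simpa using hK

/-- Writes a truncated variable as the mean of two variables with the original law, so that bounds
for truncated sums pass to the full sums. -/
theorem add_outerNeg (K x : ℝ) : x + outerNeg K x = 2 * truncate K x := by
  unfold truncate outerNeg
  split_ifs <;> ring

omit [IsProbabilityMeasure ν] in
theorem measurePreserving_outerNeg (hν : MeasurePreserving Neg.neg ν ν) (K : ℝ) :
    MeasurePreserving (outerNeg K) ν ν := by
  refine ⟨measurable_outerNeg K, Measure.ext fun s hs => ?_⟩
  have hB : MeasurableSet {x : ℝ | |x| ≤ K} := measurableSet_le (by fun_prop) measurable_const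
  rw [Measure.map_apply (measurable_outerNeg K) hs, ← measure_inter_add_sdiff (outerNeg K ⁻¹' s) hB,
    ← measure_inter_add_sdiff s hB, ← hν.measure_preimage (hs.diff hB).nullMeasurableSet]
  congr 2
  · ext x
    simp only [Set.mem_inter_iff, Set.mem_preimage, Set.mem_ofPred_eq, outerNeg]
    refine and_congr_left fun h => ?_
    rw [if_pos h]
  · ext x
    simp only [Set.mem_sdiff, Set.mem_preimage, Set.mem_ofPred_eq, outerNeg, abs_neg]
    refine and_congr_left fun h => ?_
    rw [if_neg h]

theorem exists_truncate_sq_pos (hpos : 0 < ν.real (Set.Ici 1)) :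
    ∃ K : ℝ, 0 ≤ K ∧ 0 < ∫ x, truncate K x ^ 2 ∂ν := by
  have h : ∃ n : ℕ, ν (Set.Icc 1 (n : ℝ)) ≠ 0 := by
    by_contra! h
    have h2 := measure_iUnion_null h
    have h3 : Set.Ici (1 : ℝ) ⊆ ⋃ n : ℕ, Set.Icc 1 (n : ℝ) := fun x hx => by
      obtain ⟨n, hn⟩ := exists_nat_ge x
      exact Set.mem_iUnion.mpr ⟨n, hx, hn⟩
    rw [measureReal_def, measure_mono_null h3 h2] at hpos
    simp at hpos
  obtain ⟨n, hn⟩ := h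
  refine ⟨n, n.cast_nonneg, ?_⟩
  have h1 : 0 < ν.real (Set.Icc 1 (n : ℝ)) :=
    ENNReal.toReal_pos hn (measure_ne_top _ _)
  have hI : Integrable (fun x => truncate n x ^ 2) ν := by
    refine Integrable.of_bound (by have := measurable_truncate n; fun_prop) ((n : ℝ) ^ 2)
      (ae_of_all _ fun x => ?_)
    rw [Real.norm_eq_abs, abs_pow]
    have := abs_truncate_le n.cast_nonneg x
    gcongr
  have h2 : ∫ x, (Set.Icc 1 (n : ℝ)).indicator (fun _ => (1 : ℝ)) x ∂ν ≤
      ∫ x, truncate n x ^ 2 ∂ν := by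
    refine integral_mono ((integrable_const _).indicator measurableSet_Icc) hI fun x => ?_
    by_cases hx : x ∈ Set.Icc 1 (n : ℝ)
    · simp only [Set.indicator_of_mem hx, truncate]
      rw [if_pos (abs_le.mpr ⟨by linarith [hx.1, hx.2], hx.2⟩)]
      nlinarith [hx.1]
    · simp only [Set.indicator_of_notMem hx]
      positivity
  rw [integral_indicator_const _ measurableSet_Icc] at h2
  simp only [smul_eq_mul, mul_one] at h2
  linarith

/-- Independent symmetric variables: a weighted sum exceeds a fixed multiple of the Euclidean norm
of the weights with a probability bounded below, uniformly in the weights. -/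
theorem exists_anticoncentration (ι : Type*) (hν : MeasurePreserving Neg.neg ν ν)
    (hpos : 0 < ν.real (Set.Ici 1)) :
    ∃ c : ℝ, 0 < c ∧ ∃ p : ℝ, 0 < p ∧ ∀ (a : ι → ℝ) (S : Finset ι), 0 < ∑ x ∈ S, a x ^ 2 →
      p ≤ (Measure.infinitePi fun _ : ι => ν).real
        {η | c * √(∑ x ∈ S, a x ^ 2) ≤ ∑ x ∈ S, a x * η x} := by
  obtain ⟨K, hK0, hm⟩ := exists_truncate_sq_pos hpos
  set f := truncate K with hf
  have mf : Measurable f := measurable_truncate K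
  set m := ∫ x, f x ^ 2 ∂ν with hm_def
  have hm4 : 0 ≤ ∫ x, f x ^ 4 ∂ν := integral_nonneg fun x => by positivity
  set C := 3 * m ^ 2 + ∫ x, f x ^ 4 ∂ν with hC
  have hC0 : 0 < C := by positivity
  -- The probability is one quarter of the Paley–Zygmund bound: four events of equal probability
  -- will cover.
  refine ⟨√(m / 2), by positivity, 1 / (4 * (1 / (4 * (C / m ^ 2)))⁻¹), by positivity,
    fun a S hV => ?_⟩
  set μ := Measure.infinitePi fun _ : ι => ν with hμ
  set V := ∑ x ∈ S, a x ^ 2 with hV_def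
  obtain ⟨h2, h4⟩ := weightedSum_moments hν mf (abs_truncate_le hK0) (truncate_neg K) a
    (C := C) (by linarith) (by linarith [sq_nonneg m]) S
  set Y : (ι → ℝ) → ℝ := fun η => ∑ x ∈ S, a x * f (η x) with hY
  have mY : Measurable Y := by fun_prop
  have hYp : ∀ p : ℕ, Integrable (fun η => Y η ^ p) μ := fun p => by
    simpa using integrable_pow_mul_pow (μ := μ) mY mY
      (abs_weightedSum_le (abs_truncate_le hK0) a S)
      (abs_weightedSum_le (abs_truncate_le hK0) a S) p 0
  have hPZ := paley_zygmund_fourth mY (hYp 2) (hYp 4) (v := m * V) (C := C / m ^ 2)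
    (by positivity) (by positivity) h2 (h4.trans_eq (by field_simp; rfl))
  set E := {η : ι → ℝ | √(m / 2) * √V ≤ ∑ x ∈ S, a x * η x} with hE
  have mE : MeasurableSet E := measurableSet_le measurable_const (by fun_prop)
  have hφ := measurePreserving_outerNeg hν K
  have e1 := (measurePreserving_infinitePi_map (ι := ι) hφ).measureReal_preimage
    mE.nullMeasurableSet
  have e2 := (measurePreserving_infinitePi_map (ι := ι) hν).measureReal_preimage
    mE.nullMeasurableSet
  have e3 := (measurePreserving_infinitePi_map (ι := ι) (hν.comp hφ)).measureReal_preimage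
    mE.nullMeasurableSet
  -- Since $2Y$ is the sum of the original and the outer-reflected sums, a large $|Y|$ forces one of
  -- these two, or one of their negatives, above the threshold.
  have hsub : {η | m * V / 2 ≤ Y η ^ 2} ⊆
      (E ∪ (fun (η : ι → ℝ) x => outerNeg K (η x)) ⁻¹' E) ∪
        ((fun (η : ι → ℝ) x => -(η x)) ⁻¹' E ∪
          (fun (η : ι → ℝ) x => (Neg.neg ∘ outerNeg K) (η x)) ⁻¹' E) := by
    intro η hη
    have hY2 : 2 * Y η = ∑ x ∈ S, a x * η x + ∑ x ∈ S, a x * outerNeg K (η x) := by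
      rw [← Finset.sum_add_distrib, hY, Finset.mul_sum]
      refine Finset.sum_congr rfl fun x _ => ?_
      rw [← mul_add, add_outerNeg]
      ring
    have hs : √(m / 2) * √V ≤ |Y η| := by
      rw [← Real.sqrt_mul (by positivity), ← Real.sqrt_sq_eq_abs]
      refine Real.sqrt_le_sqrt ?_
      have : m * V / 2 ≤ Y η ^ 2 := hη
      linarith
    simp only [hE, Set.mem_union, Set.mem_preimage, Set.mem_ofPred_eq, Function.comp_apply,
      mul_neg, Finset.sum_neg_distrib]
    by_contra! hcon
    obtain ⟨⟨h1, h2⟩, h3, h4⟩ := hcon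
    rcases abs_cases (Y η) with h | h <;> linarith
  have hle := (measureReal_mono hsub (μ := μ)).trans ((measureReal_union_le _ _).trans
    (add_le_add (measureReal_union_le _ _) (measureReal_union_le _ _)))
  rw [e1, e2, e3] at hle
  rw [one_div, mul_inv, inv_inv]
  linarith

/-- Greedy choice: stop when the sum first reaches $M$; the last term overshoots by at most $M$. -/
theorem exists_subset_sum_mem_Icc [DecidableEq ι] {w : ι → ℝ} {M : ℝ} (hw : ∀ x, w x ≤ M)
    (S : Finset ι) (hS : M ≤ ∑ x ∈ S, w x) (hM : 0 < M) :
    ∃ T ⊆ S, M ≤ ∑ x ∈ T, w x ∧ ∑ x ∈ T, w x ≤ 2 * M := by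
  induction S using Finset.induction_on with
  | empty => simp at hS; linarith
  | insert i S hi ih =>
    by_cases h : M ≤ ∑ x ∈ S, w x
    · obtain ⟨T, hT, h1⟩ := ih h
      exact ⟨T, hT.trans (Finset.subset_insert _ _), h1⟩
    · refine ⟨_, subset_rfl, hS, ?_⟩
      rw [Finset.sum_insert hi]
      linarith [hw i]

/-- Peel off $k$ disjoint groups of norm at least $\sqrt M$, which succeed independently. Capping
the weights at $M$ ensures that a group uses at most $2M$ of the budget; the leftover costs the
factor $1/2$. -/
theorem half_mul_pow_le_of_groups (hν : MeasurePreserving Neg.neg ν ν) {c p : ℝ} (hc : 0 ≤ c)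
    (hp : 0 ≤ p)
    (hcp : ∀ (a : ι → ℝ) (S : Finset ι), 0 < ∑ x ∈ S, a x ^ 2 →
      p ≤ (Measure.infinitePi fun _ : ι => ν).real
        {η | c * √(∑ x ∈ S, a x ^ 2) ≤ ∑ x ∈ S, a x * η x})
    (a : ι → ℝ) {M : ℝ} (hM : 0 < M) (k : ℕ) (S : Finset ι)
    (hS : 2 * k * M ≤ ∑ x ∈ S, min (a x ^ 2) M) :
    1 / 2 * p ^ k ≤ (Measure.infinitePi fun _ : ι => ν).real
      {η | k * (c * √M) ≤ ∑ x ∈ S, a x * η x} := by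
  classical
  induction k generalizing S with
  | zero => simpa using half_le_measureReal_sum_nonneg hν a S
  | succ k ih =>
    push_cast at hS
    obtain ⟨T, hTS, hT1, hT2⟩ := exists_subset_sum_mem_Icc (w := fun x => min (a x ^ 2) M)
      (fun x => min_le_right _ _) S (by nlinarith [mul_nonneg k.cast_nonneg hM.le]) hM
    have h1 := ih (S \ T) (by
      have := Finset.sum_sdiff hTS (f := fun x => min (a x ^ 2) M)
      linarith)
    have hV : M ≤ ∑ x ∈ T, a x ^ 2 :=
      hT1.trans (Finset.sum_le_sum fun x _ => min_le_left _ _)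
    have h2 := hcp a T (by linarith)
    have h3 := measureReal_sum_superposition (ν := ν) a (Finset.sdiff_disjoint (s := T) (t := S))
      (k * (c * √M)) (c * √(∑ x ∈ T, a x ^ 2))
    rw [Finset.sdiff_union_of_subset hTS] at h3
    have h4 : 1 / 2 * p ^ (k + 1) = (1 / 2 * p ^ k) * p := by ring
    rw [h4]
    refine (mul_le_mul h1 h2 hp measureReal_nonneg).trans (h3.trans ?_)
    refine measureReal_mono fun η hη => ?_
    simp only [Set.mem_ofPred_eq] at hη ⊢
    refine le_trans ?_ hη
    have : c * √M ≤ c * √(∑ x ∈ T, a x ^ 2) := by gcongr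
    push_cast
    linarith

/-- If the capped mass is below $2kM$, at most $2k$ sites have $a_x^2\ge M$. On the other sites
$a_x\le a_x^2$, so they carry at most $2kM\le\frac12\sum a_x$. The heavy sites thus carry half of
the total weight and are raised to level $t$. -/
theorem half_mul_pow_le_measureReal_sum (hν : MeasurePreserving Neg.neg ν ν) {c p : ℝ} (hc : 0 ≤ c)
    (hp : 0 ≤ p)
    (hcp : ∀ (a : ι → ℝ) (S : Finset ι), 0 < ∑ x ∈ S, a x ^ 2 →
      p ≤ (Measure.infinitePi fun _ : ι => ν).real
        {η | c * √(∑ x ∈ S, a x ^ 2) ≤ ∑ x ∈ S, a x * η x})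
    {a : ι → ℝ} (ha0 : ∀ x, 0 ≤ a x) {S : Finset ι} (ha : ∀ x ∈ S, 1 ≤ a x) {M : ℝ} (hM : 0 < M)
    {k : ℕ} (hk : 4 * k * M ≤ ∑ x ∈ S, a x) {s t : ℝ} (ht : 0 ≤ t) (hs1 : s ≤ k * (c * √M))
    (hs2 : s ≤ t * ((∑ x ∈ S, a x) / 2)) :
    1 / 2 * min p (ν.real (Set.Ici t) ^ 2) ^ k ≤ (Measure.infinitePi fun _ : ι => ν).real
      {η | s ≤ ∑ x ∈ S, a x * η x} := by
  classical
  have hmin : 0 ≤ min p (ν.real (Set.Ici t) ^ 2) := le_min hp (sq_nonneg _)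
  by_cases hS : 2 * k * M ≤ ∑ x ∈ S, min (a x ^ 2) M
  · refine (mul_le_mul_of_nonneg_left (pow_le_pow_left₀ hmin (min_le_left _ _) k)
      (by norm_num)).trans ((half_mul_pow_le_of_groups hν hc hp hcp a hM k S hS).trans ?_)
    exact measureReal_mono fun η hη => hs1.trans hη
  · push Not at hS
    set L := S.filter fun x => M ≤ a x ^ 2 with hL
    have hsplit := Finset.sum_filter_add_sum_filter_not S (fun x => M ≤ a x ^ 2)
      (fun x => min (a x ^ 2) M)
    have hsplit' := Finset.sum_filter_add_sum_filter_not S (fun x => M ≤ a x ^ 2) a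
    have h1 : ∑ x ∈ L, min (a x ^ 2) M = L.card * M := by
      rw [Finset.sum_congr rfl (g := fun _ => M) fun x (hx : x ∈ L) =>
        min_eq_right (by rw [hL, Finset.mem_filter] at hx; exact hx.2), Finset.sum_const, nsmul_eq_mul]
    have h2 : ∑ x ∈ S with ¬ M ≤ a x ^ 2, a x ≤ ∑ x ∈ S with ¬ M ≤ a x ^ 2, min (a x ^ 2) M := by
      refine Finset.sum_le_sum fun x hx => ?_
      rw [Finset.mem_filter, not_le] at hx
      rw [min_eq_left hx.2.le]
      nlinarith [ha x hx.1]
    have h3 : 0 ≤ ∑ x ∈ S with ¬ M ≤ a x ^ 2, a x := Finset.sum_nonneg fun x _ => ha0 x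
    have hLM : 0 ≤ L.card * M := by positivity
    rw [← hL] at hsplit hsplit'
    have hcard : L.card ≤ 2 * k := by
      have : (L.card : ℝ) * M ≤ (2 * k : ℕ) * M := by push_cast; linarith
      exact_mod_cast le_of_mul_le_mul_right this hM
    have hLs : (∑ x ∈ S, a x) / 2 ≤ ∑ x ∈ L, a x := by linarith
    refine le_trans ?_ (half_mul_measureReal_sum_le hν a (S := L) (Finset.filter_subset _ S) s)
    refine mul_le_mul_of_nonneg_left ?_ (by norm_num)
    calc min p (ν.real (Set.Ici t) ^ 2) ^ k ≤ (ν.real (Set.Ici t) ^ 2) ^ k :=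
          pow_le_pow_left₀ hmin (min_le_right _ _) k
      _ = ν.real (Set.Ici t) ^ (2 * k) := by rw [pow_mul]
      _ ≤ ν.real (Set.Ici t) ^ L.card :=
          pow_le_pow_of_le_one measureReal_nonneg measureReal_le_one hcard
      _ ≤ _ := pow_card_le_measureReal_sum ha0 L t
      _ ≤ _ := measureReal_mono fun η hη =>
          (hs2.trans (mul_le_mul_of_nonneg_left hLs ht)).trans hη

end Anticoncentration

/-! ### Symmetry and tails of the scenery law -/

section Law

variable {ν : Measure ℝ}

theorem IsBellShaped.measurePreserving_neg (h : IsBellShaped ν) :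
    MeasurePreserving Neg.neg ν ν := by
  obtain ⟨f, hf, -, heven, -, rfl⟩ := h
  refine ⟨measurable_neg, Measure.ext fun s hs => ?_⟩
  rw [Measure.map_apply measurable_neg hs, withDensity_apply _ hs,
    withDensity_apply _ (measurable_neg hs),
    ← (Measure.measurePreserving_neg (volume : Measure ℝ)).setLIntegral_comp_preimage hs
      (by fun_prop)]
  simp only [heven]

variable [IsProbabilityMeasure ν]

theorem HasTailExponent.exists_exp_le {α κ : ℝ} (hκ : 0 < κ)
    (h : HasTailExponent ν α κ) :
    ∃ C : ℝ, 0 < C ∧ ∀ t : ℝ, 0 ≤ t → Real.exp (-C * (1 + t ^ α)) ≤ ν.real (Set.Ici t) := by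
  have h1 := (h.eventually (Ioo_mem_nhds (show -(2 * κ) < -κ by linarith)
    (show -κ < 0 by linarith))).and (eventually_gt_atTop 0)
  obtain ⟨t₀, ht₀⟩ := eventually_atTop.mp h1
  set T := max t₀ 1 with hT
  have hT0 : 0 < T := lt_of_lt_of_le one_pos (le_max_right _ _)
  have key : ∀ t, T ≤ t → Real.exp (-(2 * κ) * t ^ α) ≤ ν.real (Set.Ici t) := fun t ht => by
    obtain ⟨⟨h2, h3⟩, h4⟩ := ht₀ t ((le_max_left _ _).trans ht)
    have hpow : 0 < t ^ α := Real.rpow_pos_of_pos h4 α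
    rw [lt_div_iff₀ hpow] at h2
    -- As `Real.log 0 = 0`, the strict negativity of the quotient excludes a vanishing tail.
    have hne : ν.real (Set.Ioi t) ≠ 0 := fun h0 => by simp [h0] at h3
    have hp : 0 < ν.real (Set.Ioi t) := lt_of_le_of_ne measureReal_nonneg hne.symm
    refine le_trans ?_ (measureReal_mono Set.Ioi_subset_Ici_self)
    rw [← Real.le_log_iff_exp_le hp]
    exact h2.le
  refine ⟨2 * κ * (1 + T ^ α), by positivity, fun t ht => ?_⟩
  have hta : 0 ≤ t ^ α := Real.rpow_nonneg ht α
  have hTa : 0 ≤ T ^ α := Real.rpow_nonneg hT0.le α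
  rcases le_total T t with h5 | h5
  · refine le_trans (Real.exp_le_exp.mpr ?_) (key t h5)
    have : 0 ≤ κ * (1 + T ^ α + T ^ α * t ^ α) := by positivity
    linarith
  · refine le_trans (Real.exp_le_exp.mpr ?_)
      ((key T le_rfl).trans (measureReal_mono (Set.Ici_subset_Ici.mpr h5)))
    have : 0 ≤ κ * (1 + t ^ α + T ^ α * t ^ α) := by positivity
    linarith

end Law
-- Confinement of the simple random walk
section Walk

/-- The sequence `s`, preceded by `v`. -/
def consSeq {X : Type*} (v : X) (s : ℕ → X) : ℕ → X
  | 0 => v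
  | n + 1 => s n

/-- This is the Markov property at time one: a first step followed by an independent i.i.d. sequence
is again i.i.d. -/
theorem measurePreserving_consSeq {X : Type*} [MeasurableSpace X] (ρ : Measure X)
    [IsProbabilityMeasure ρ] :
    MeasurePreserving (fun p : X × (ℕ → X) => consSeq p.1 p.2)
      (ρ.prod (Measure.infinitePi fun _ : ℕ => ρ)) (Measure.infinitePi fun _ : ℕ => ρ) := by
  have hm : Measurable (fun p : X × (ℕ → X) => consSeq p.1 p.2) := by
    refine measurable_pi_lambda _ fun n => ?_
    cases n with
    | zero => exact measurable_fst
    | succ n => exact (measurable_pi_apply n).comp measurable_snd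
  refine ⟨hm, Measure.eq_infinitePi (fun _ : ℕ => ρ) fun s t ht => ?_⟩
  classical
  obtain ⟨N, hN⟩ := s.exists_nat_subset_range
  -- The cylinder is padded to an initial segment of indices, so that coordinate `0` always splits
  -- off.
  set t' : ℕ → Set X := fun i => if i ∈ s then t i else Set.univ with ht'
  have mt' : ∀ i, MeasurableSet (t' i) := fun i => by
    simp only [ht']
    split_ifs
    exacts [ht i, MeasurableSet.univ]
  have hpi : (s : Set ℕ).pi t = ((Finset.range (N + 1) : Finset ℕ) : Set ℕ).pi t' := by
    ext u
    simp only [Set.mem_pi, Finset.mem_coe, ht']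
    constructor
    · intro h i _
      split_ifs with hi
      exacts [h i hi, Set.mem_univ _]
    · intro h i hi
      simpa [hi] using h i (Finset.range_subset_range.mpr N.le_succ (hN hi))
  have hprod : ∏ i ∈ s, ρ (t i) = ∏ i ∈ Finset.range (N + 1), ρ (t' i) := by
    rw [← Finset.prod_subset (hN.trans (Finset.range_subset_range.mpr N.le_succ))]
    · exact Finset.prod_congr rfl fun i hi => by simp [ht', hi]
    · intro i _ hi
      simp [ht', hi]
  have hpre : (fun p : X × (ℕ → X) => consSeq p.1 p.2) ⁻¹'
      ((Finset.range (N + 1) : Finset ℕ) : Set ℕ).pi t' =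
      t' 0 ×ˢ ((Finset.range N : Finset ℕ) : Set ℕ).pi fun i => t' (i + 1) := by
    ext ⟨v, u⟩
    simp only [Set.mem_preimage, Set.mem_pi, Finset.mem_coe, Finset.mem_range, Set.mem_prod]
    constructor
    · intro h
      exact ⟨h 0 N.succ_pos, fun i hi => h (i + 1) (by omega)⟩
    · rintro ⟨h0, h1⟩ i hi
      cases i with
      | zero => exact h0
      | succ i => exact h1 i (by omega)
  rw [hpi, hprod, Measure.map_apply hm
    (MeasurableSet.pi (Finset.countable_toSet _) fun i _ => mt' i), hpre, Measure.prod_prod,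
    Measure.infinitePi_pi (fun _ : ℕ => ρ) fun i _ => mt' (i + 1), Finset.prod_range_succ',
    mul_comm]

variable {d : ℕ}

/-- The position after `k` steps of the path with steps `s`. -/
def position (s : ℕ → Fin d → ℤ) (k : ℕ) : Fin d → ℤ := ∑ j ∈ Finset.range k, s j

theorem position_consSeq_succ (v : Fin d → ℤ) (s : ℕ → Fin d → ℤ) (k : ℕ) :
    position (consSeq v s) (k + 1) = v + position s k := by
  rw [position, Finset.sum_range_succ', add_comm]
  rfl

theorem measurable_position (k : ℕ) :
    Measurable fun s : ℕ → Fin d → ℤ => position s k := by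
  unfold position
  fun_prop

/-- The unit steps, indexed by a coordinate and a sign. -/
def unitStep (p : Fin d × Bool) : Fin d → ℤ := Pi.single p.1 (if p.2 then 1 else -1)

theorem unitStep_injective : Function.Injective (unitStep (d := d)) := by
  rintro ⟨i, b⟩ ⟨j, b'⟩ h
  have hi := congrFun h i
  simp only [unitStep, Pi.single_eq_same] at hi
  by_cases hij : i = j
  · subst hij
    simp only [Pi.single_eq_same] at hi
    cases b <;> cases b' <;> simp_all
  · rw [Pi.single_eq_of_ne hij] at hi
    cases b <;> simp at hi

theorem range_unitStep : Set.range (unitStep (d := d)) = unitSteps d := by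
  ext v
  constructor
  · rintro ⟨⟨i, b⟩, rfl⟩
    refine ⟨i, ?_⟩
    cases b
    · exact Or.inr (by simp [unitStep, Pi.single_neg])
    · exact Or.inl (by simp [unitStep])
  · rintro ⟨i, rfl | rfl⟩
    · exact ⟨(i, true), by simp [unitStep]⟩
    · exact ⟨(i, false), by simp [unitStep, Pi.single_neg]⟩

theorem stepLaw_real_singleton (p : Fin d × Bool) :
    (stepLaw d).real {unitStep p} = 1 / (2 * d) := by
  classical
  have h1 : unitSteps d = ((Finset.univ.image (unitStep (d := d)) : Finset (Fin d → ℤ)) :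
      Set (Fin d → ℤ)) := by
    rw [← range_unitStep]
    simp
  have h2 : (stepLaw d) {unitStep p} = 1 / (2 * d) := by
    rw [stepLaw, h1, ← Finset.coe_singleton, uniformOn_apply_finset,
      Finset.card_image_of_injective _ unitStep_injective,
      Finset.inter_singleton_of_mem (Finset.mem_image_of_mem _ (Finset.mem_univ p))]
    simp [mul_comm]
  rw [measureReal_def, h2]
  simp

/-- The path from `x` with steps `s` stays in the open cube of radius `R` for `m` steps. -/
def confined (R : ℕ) (m : ℕ) (x : Fin d → ℤ) : Set (ℕ → Fin d → ℤ) :=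
  {s | ∀ k ≤ m, ∀ i, |(x + position s k) i| < R}

theorem measurableSet_confined (R m : ℕ) (x : Fin d → ℤ) : MeasurableSet (confined R m x) := by
  have h : confined R m x = ⋂ k, ⋂ _ : k ≤ m,
      (fun s : ℕ → Fin d → ℤ => position s k) ⁻¹' {z | ∀ i, |(x + z) i| < R} := by
    ext s
    simp [confined]
  rw [h]
  exact MeasurableSet.iInter fun k => MeasurableSet.iInter fun _ =>
    measurable_position k (Set.to_countable _).measurableSet

/-- The principal Dirichlet eigenfunction of the cube of radius `R`. -/
noncomputable def cubeEigenfunction (R : ℕ) (x : Fin d → ℤ) : ℝ :=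
  ∏ i, Real.cos (Real.pi / (2 * R) * x i)

theorem cubeEigenfunction_le_one (R : ℕ) (x : Fin d → ℤ) : cubeEigenfunction R x ≤ 1 := by
  refine (le_abs_self _).trans ?_
  rw [cubeEigenfunction, Finset.abs_prod]
  exact Finset.prod_le_one (fun i _ => abs_nonneg _) fun i _ => Real.abs_cos_le_one _

theorem cubeEigenfunction_eq_zero {R : ℕ} (hR : 0 < R) {x : Fin d → ℤ} {i : Fin d}
    (hi : |x i| = R) : cubeEigenfunction R x = 0 := by
  refine Finset.prod_eq_zero (Finset.mem_univ i) ?_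
  have hR' : (R : ℝ) ≠ 0 := by positivity
  rcases eq_or_eq_neg_of_abs_eq hi with h | h
  · rw [h, Int.cast_natCast, show Real.pi / (2 * R) * (R : ℝ) = Real.pi / 2 by field_simp,
      Real.cos_pi_div_two]
  · rw [h, Int.cast_neg, Int.cast_natCast,
      show Real.pi / (2 * R) * -(R : ℝ) = -(Real.pi / 2) by field_simp, Real.cos_neg,
      Real.cos_pi_div_two]

theorem cubeEigenfunction_add_unitStep (R : ℕ) (x : Fin d → ℤ) (i : Fin d) :
    cubeEigenfunction R (x + unitStep (i, true)) + cubeEigenfunction R (x + unitStep (i, false)) =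
      2 * Real.cos (Real.pi / (2 * R)) * cubeEigenfunction R x := by
  have h : ∀ b : Bool, cubeEigenfunction R (x + unitStep (i, b)) =
      Real.cos (Real.pi / (2 * R) * (x i + if b then 1 else -1)) *
        ∏ j ∈ Finset.univ.erase i, Real.cos (Real.pi / (2 * R) * x j) := fun b => by
    rw [cubeEigenfunction, ← Finset.mul_prod_erase _ _ (Finset.mem_univ i)]
    congr 1
    · cases b <;> simp [unitStep]
    · refine Finset.prod_congr rfl fun j hj => ?_
      rw [Pi.add_apply, unitStep, Pi.single_eq_of_ne (Finset.ne_of_mem_erase hj), add_zero]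
  rw [h, h, cubeEigenfunction, ← Finset.mul_prod_erase _ _ (Finset.mem_univ i), ← add_mul]
  simp only [if_true, Bool.false_eq_true, if_false, mul_add, mul_neg, mul_one, Real.cos_add,
    Real.cos_neg, Real.sin_neg]
  ring

theorem sum_cubeEigenfunction (R : ℕ) (x : Fin d → ℤ) :
    ∑ p : Fin d × Bool, cubeEigenfunction R (x + unitStep p) =
      2 * d * (Real.cos (Real.pi / (2 * R)) * cubeEigenfunction R x) := by
  rw [Fintype.sum_prod_type]
  simp only [Fintype.sum_bool, cubeEigenfunction_add_unitStep]
  simp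
  ring

/-- Comparison after conditioning on the first step: averaging over neighbours multiplies the
eigenfunction by $\cos(\pi/2R)$. It is at most $1$ at time zero and vanishes on the faces, the only
exits available in one step. -/
theorem pow_mul_cubeEigenfunction_le (hd : 1 ≤ d) {R : ℕ} (hR : 0 < R) (m : ℕ) (x : Fin d → ℤ)
    (hx : ∀ i, |x i| ≤ R) :
    Real.cos (Real.pi / (2 * R)) ^ m * cubeEigenfunction R x ≤
      (Measure.infinitePi fun _ : ℕ => stepLaw d).real (confined R m x) := by
  have := isProbabilityMeasure_stepLaw hd
  by_cases hint : ∀ i, |x i| < R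
  swap
  · push Not at hint
    obtain ⟨i, hi⟩ := hint
    rw [cubeEigenfunction_eq_zero hR (le_antisymm (hx i) hi), mul_zero]
    exact measureReal_nonneg
  induction m generalizing x with
  | zero =>
    have : confined R 0 x = Set.univ := by
      ext s
      simpa [confined, position] using hint
    rw [this, probReal_univ, pow_zero, one_mul]
    exact cubeEigenfunction_le_one R x
  | succ m ih =>
    set μ := Measure.infinitePi fun _ : ℕ => stepLaw d with hμ
    have hstep : ∀ p : Fin d × Bool,
        Real.cos (Real.pi / (2 * R)) ^ m * cubeEigenfunction R (x + unitStep p) ≤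
          μ.real (confined R m (x + unitStep p)) := fun p => by
      by_cases h : ∀ i, |(x + unitStep p) i| < R
      · exact ih _ (fun i => (h i).le) h
      · push Not at h
        obtain ⟨i, hi⟩ := h
        have hle : |(x + unitStep p) i| ≤ R := by
          have h1 : |unitStep p i| ≤ 1 := by
            rw [unitStep, Pi.single_apply]
            split_ifs <;> simp
          have h2 := abs_add_le (x i) (unitStep p i)
          have h3 := hint i
          rw [Pi.add_apply]
          omega
        rw [cubeEigenfunction_eq_zero hR (le_antisymm hle hi), mul_zero]
        exact measureReal_nonneg
    have hsub : (⋃ p ∈ (Finset.univ : Finset (Fin d × Bool)),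
        ({unitStep p} : Set (Fin d → ℤ)) ×ˢ confined R m (x + unitStep p)) ⊆
        (fun q : (Fin d → ℤ) × (ℕ → Fin d → ℤ) => consSeq q.1 q.2) ⁻¹' confined R (m + 1) x := by
      rintro ⟨v, s⟩ hvs
      simp only [Finset.mem_univ, Set.iUnion_true, Set.mem_iUnion, Set.mem_prod,
        Set.mem_singleton_iff] at hvs
      obtain ⟨p, rfl, hs⟩ := hvs
      intro k hk
      cases k with
      | zero => simpa [position] using hint
      | succ k =>
        simp only [position_consSeq_succ, ← add_assoc]
        exact hs k (by omega)
    have hmeas := (measurePreserving_consSeq (stepLaw d)).measureReal_preimage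
      (measurableSet_confined R (m + 1) x).nullMeasurableSet
    have hle := measureReal_mono hsub (μ := (stepLaw d).prod μ)
    rw [hmeas, measureReal_biUnion_finset] at hle
    · refine le_trans ?_ hle
      simp only [measureReal_prod_prod, stepLaw_real_singleton]
      rw [← Finset.mul_sum]
      calc _ = 1 / (2 * d) * ∑ p : Fin d × Bool,
            Real.cos (Real.pi / (2 * R)) ^ m * cubeEigenfunction R (x + unitStep p) := by
            rw [← Finset.mul_sum, sum_cubeEigenfunction]
            have : (d : ℝ) ≠ 0 := by positivity
            field_simp
            ring
        _ ≤ _ := by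
            gcongr with p
            exact hstep p
    · intro p _ q _ hpq
      refine Set.disjoint_left.mpr ?_
      rintro ⟨v, s⟩ ⟨h1, -⟩ ⟨h2, -⟩
      exact hpq (unitStep_injective ((Set.mem_singleton_iff.mp h1).symm.trans
        (Set.mem_singleton_iff.mp h2)))
    · intro p _
      exact (measurableSet_singleton _).prod (measurableSet_confined _ _ _)

theorem exp_neg_sq_le_cos {θ : ℝ} (h : |θ| ≤ 1) : Real.exp (-θ ^ 2) ≤ Real.cos θ := by
  have h1 := Real.one_sub_sq_div_two_le_cos (x := θ)
  have h2 := Real.add_one_le_exp (θ ^ 2)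
  have h3 : θ ^ 2 ≤ 1 := (sq_le_one_iff_abs_le_one θ).mpr h
  refine le_trans ?_ h1
  rw [Real.exp_neg, inv_le_comm₀ (Real.exp_pos _) (by linarith)]
  refine le_trans ?_ h2
  rw [inv_le_iff_one_le_mul₀ (by linarith)]
  nlinarith [sq_nonneg θ]

/-- The walk stays in a cube of radius `R` for `m` steps with probability at least
`exp (-C m / R ^ 2)`. -/
theorem exp_le_measureReal_confined (hd : 1 ≤ d) {R : ℕ} (hR : 2 ≤ R) (m : ℕ) :
    Real.exp (-(3 * m / R ^ 2)) ≤
      (Measure.infinitePi fun _ : ℕ => stepLaw d).real (confined R m (0 : Fin d → ℤ)) := by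
  have h := pow_mul_cubeEigenfunction_le hd (by omega : 0 < R) m 0 (by simp)
  have h0 : cubeEigenfunction R (0 : Fin d → ℤ) = 1 := by simp [cubeEigenfunction]
  rw [h0, mul_one] at h
  refine le_trans ?_ h
  have hR' : (2 : ℝ) ≤ R := by exact_mod_cast hR
  have hpi := Real.pi_pos
  have hpi4 := Real.pi_lt_d2
  have hθ : |Real.pi / (2 * R)| ≤ 1 := by
    rw [abs_of_nonneg (by positivity), div_le_one (by positivity)]
    linarith
  refine le_trans ?_ (pow_le_pow_left₀ (Real.exp_pos _).le (exp_neg_sq_le_cos hθ) m)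
  rw [← Real.exp_nat_mul, Real.exp_le_exp, div_pow, mul_neg, neg_le_neg_iff, ← mul_div_assoc,
    mul_comm 3, div_le_div_iff₀ (by positivity) (by positivity)]
  -- The constant $3$ in the exponent bounds $\pi^2/4$.
  have : Real.pi ^ 2 ≤ 12 := by nlinarith
  have h2 : 0 ≤ (m : ℝ) * R ^ 2 := by positivity
  nlinarith

end Walk
-- Local times
section LocalTime

variable {ι : Type*} [DecidableEq ι]

/-- The number of visits of the path `g` to `x` up to time `n`. -/
def localTime (g : ℕ → ι) (n : ℕ) (x : ι) : ℝ :=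
  ((Finset.range (n + 1)).filter fun k => g k = x).card

theorem localTime_nonneg (g : ℕ → ι) (n : ℕ) (x : ι) : 0 ≤ localTime g n x :=
  Nat.cast_nonneg _

theorem sum_comp_path (g : ℕ → ι) (n : ℕ) (η : ι → ℝ) :
    ∑ k ∈ Finset.range (n + 1), η (g k) =
      ∑ x ∈ (Finset.range (n + 1)).image g, localTime g n x * η x := by
  rw [Finset.sum_comp]
  simp only [nsmul_eq_mul, localTime]

theorem sum_localTime (g : ℕ → ι) (n : ℕ) :
    ∑ x ∈ (Finset.range (n + 1)).image g, localTime g n x = n + 1 := by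
  have := sum_comp_path g n fun _ => (1 : ℝ)
  simpa using this.symm

theorem one_le_localTime {g : ℕ → ι} {n : ℕ} {x : ι} (hx : x ∈ (Finset.range (n + 1)).image g) :
    1 ≤ localTime g n x := by
  obtain ⟨k, hk, rfl⟩ := Finset.mem_image.mp hx
  have : 0 < ((Finset.range (n + 1)).filter fun j => g j = g k).card :=
    Finset.card_pos.mpr ⟨k, Finset.mem_filter.mpr ⟨hk, rfl⟩⟩
  rw [localTime]
  exact_mod_cast this

theorem localTime_mono (g : ℕ → ι) {m n : ℕ} (h : m ≤ n) (x : ι) :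
    localTime g m x ≤ localTime g n x := by
  rw [localTime, localTime]
  exact_mod_cast Finset.card_le_card
    (Finset.filter_subset_filter _ (Finset.range_subset_range.mpr (by omega)))

/-- There are $\lfloor m/2\rfloor+1$ even times up to $m$. -/
theorem half_le_localTime {g : ℕ → ι} {x : ι} {m : ℕ} (hg : ∀ j, 2 * j ≤ m → g (2 * j) = x) :
    ((m : ℝ) + 1) / 2 ≤ localTime g m x := by
  have h : (Finset.range (m / 2 + 1)).image (2 * ·) ⊆
      (Finset.range (m + 1)).filter fun k => g k = x := fun k hk => by
    obtain ⟨j, hj, rfl⟩ := Finset.mem_image.mp hk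
    rw [Finset.mem_range] at hj
    exact Finset.mem_filter.mpr ⟨Finset.mem_range.mpr (by omega), hg j (by omega)⟩
  have h2 := Finset.card_le_card h
  rw [Finset.card_image_of_injective _ fun a b hab => by simpa using hab, Finset.card_range] at h2
  have h3 : m + 1 ≤ 2 * ((Finset.range (m + 1)).filter fun k => g k = x).card := by omega
  have h4 : ((m + 1 : ℕ) : ℝ) ≤ ((2 * ((Finset.range (m + 1)).filter fun k => g k = x).card : ℕ) :
    ℝ) := by exact_mod_cast h3
  push_cast at h4
  rw [localTime]
  linarith

end LocalTime

/-! ### Scenery bounds along a fixed path -/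

section Path

variable {ι : Type*} [DecidableEq ι] {ν : Measure ℝ} [IsProbabilityMeasure ν]

/-- Cost of a high scenery on a set of visited sites. -/
theorem half_mul_pow_le_of_sites (hν : MeasurePreserving Neg.neg ν ν) (g : ℕ → ι) {n : ℕ}
    {L : Finset ι} (hL : L ⊆ (Finset.range (n + 1)).image g) {s t : ℝ}
    (h : s ≤ t * ∑ x ∈ L, localTime g n x) :
    1 / 2 * ν.real (Set.Ici t) ^ L.card ≤ (Measure.infinitePi fun _ : ι => ν).real
      {η | s ≤ ∑ k ∈ Finset.range (n + 1), η (g k)} := by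
  simp only [sum_comp_path]
  refine le_trans ?_ (half_mul_measureReal_sum_le hν _ hL s)
  refine mul_le_mul_of_nonneg_left ?_ (by norm_num)
  exact (pow_card_le_measureReal_sum (localTime_nonneg g n) L t).trans
    (measureReal_mono fun η hη => h.trans hη)

/-- The factor $1/2$ is absorbed by $e^{-1}\le 1/2$, using $X\ge 1$. -/
theorem exp_le_half_mul_pow {r D X : ℝ} (hr0 : 0 < r) (hr1 : r ≤ 1) (hX : 1 ≤ X) {k : ℕ}
    (hk : k ≤ D * X) : Real.exp (-(1 + D * -Real.log r) * X) ≤ 1 / 2 * r ^ k := by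
  have h1 : Real.exp (-1) ≤ 1 / 2 := by
    rw [Real.exp_neg, one_div]
    have := Real.add_one_le_exp (1 : ℝ)
    exact inv_anti₀ (by norm_num) (by linarith)
  have h2 : r ^ k = Real.exp (k * Real.log r) := by
    rw [Real.exp_nat_mul, Real.exp_log hr0]
  refine le_trans ?_ (mul_le_mul_of_nonneg_right h1 (by positivity))
  rw [h2, ← Real.exp_add, Real.exp_le_exp]
  have hl : Real.log r ≤ 0 := Real.log_nonpos hr0.le hr1
  nlinarith

/-- Whatever the path, the scenery along it is of order `n ^ β` with probability at least
`exp (-c n ^ (2 β - 1))`. -/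
theorem exists_exp_le_path (ι : Type*) [DecidableEq ι] (hν : MeasurePreserving Neg.neg ν ν)
    (hpos : ∀ t, 0 ≤ t → 0 < ν.real (Set.Ici t)) {β : ℝ} (hβ : 1 / 2 < β) (hβ1 : β ≤ 1) {y : ℝ}
    (hy : 0 < y) :
    ∃ C : ℝ, 0 < C ∧ ∀ n : ℕ, 1 ≤ n → ∀ g : ℕ → ι,
      Real.exp (-C * (n : ℝ) ^ (2 * β - 1)) ≤ (Measure.infinitePi fun _ : ι => ν).real
        {η | (n : ℝ) ^ β * y ≤ ∑ k ∈ Finset.range (n + 1), η (g k)} := by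
  obtain ⟨c, hc, p, hp, hcp⟩ := exists_anticoncentration ι hν (hpos 1 zero_le_one)
  set r := min p (ν.real (Set.Ici (2 * y)) ^ 2) with hr
  have hr0 : 0 < r := lt_min hp (pow_pos (hpos _ (by positivity)) 2)
  have hr1 : r ≤ 1 := (min_le_right _ _).trans (pow_le_one₀ measureReal_nonneg measureReal_le_one)
  set a := 1 / (4 * (y / c + 1)) with ha
  have ha0 : 0 < a := by positivity
  have ha1 : a ≤ 1 := by
    rw [ha, div_le_one (by positivity)]
    have : 0 < y / c := by positivity
    linarith
  have ha4 : 4 * (a * (y / c + 1)) = 1 := by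
    rw [ha]
    field_simp
  -- About $BX$ groups of norm $aW$ yield $BX\cdot caW=yn^\beta$. The weight condition follows from
  -- $4(B+1)a^2=4a(y/c+a)\le 4a(y/c+1)=1$, which fixes $a$.
  set B := y / (c * a) with hB
  have hB0 : 0 < B := by positivity
  have hlog : 0 ≤ -Real.log r := neg_nonneg.mpr (Real.log_nonpos hr0.le hr1)
  refine ⟨1 + (B + 1) * -Real.log r, by positivity, fun n hn g => ?_⟩
  have hn1 : (1 : ℝ) ≤ n := by exact_mod_cast hn
  have hn0 : (0 : ℝ) < n := by linarith
  set X := (n : ℝ) ^ (2 * β - 1) with hX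
  set W := (n : ℝ) ^ (1 - β) with hW
  have hX1 : 1 ≤ X := Real.one_le_rpow hn1 (by linarith)
  have hW0 : 0 < W := Real.rpow_pos_of_pos hn0 _
  have hXW : X * W = (n : ℝ) ^ β := by
    rw [hX, hW, ← Real.rpow_add hn0]
    congr 1
    ring
  have hXWW : X * W ^ 2 = n := by
    rw [pow_two, ← mul_assoc, hXW, hW, ← Real.rpow_add hn0]
    simp
  have hk1 : B * X ≤ ⌈B * X⌉₊ := Nat.le_ceil _
  have hk2 : (⌈B * X⌉₊ : ℝ) ≤ (B + 1) * X := by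
    have := Nat.ceil_lt_add_one (show 0 ≤ B * X by positivity)
    linarith
  refine (exp_le_half_mul_pow hr0 hr1 hX1 hk2).trans ?_
  simp only [sum_comp_path]
  refine half_mul_pow_le_measureReal_sum hν hc.le hp.le hcp (localTime_nonneg g n)
    (fun x hx => one_le_localTime hx) (M := (a * W) ^ 2) (by positivity) ?_
    (by positivity) ?_ ?_
  · rw [sum_localTime]
    calc 4 * (⌈B * X⌉₊ : ℝ) * (a * W) ^ 2 ≤ 4 * ((B + 1) * X) * (a * W) ^ 2 := by gcongr
      _ = 4 * ((B * a + a) * a) * (X * W ^ 2) := by ring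
      _ = 4 * (a * (y / c + a)) * n := by
        rw [hXWW, hB]
        congr 2
        field_simp
      _ ≤ 4 * (a * (y / c + 1)) * n := by gcongr
      _ ≤ n + 1 := by rw [ha4]; linarith
  · rw [Real.sqrt_sq (by positivity)]
    calc (n : ℝ) ^ β * y = B * X * (c * (a * W)) := by
          rw [← hXW, hB]
          field_simp
      _ ≤ _ := by gcongr
  -- The level $2y$ on half of the local time gives $y(n+1)\ge yn^\beta$; this uses $\beta\le 1$.
  · rw [sum_localTime]
    have : (n : ℝ) ^ β ≤ n := by
      simpa using Real.rpow_le_rpow_of_exponent_le hn1 hβ1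
    nlinarith

end Path

/-! ### Averaging over the walk -/

section Averaged

/-- Tonelli, applied to a measurable hull of `E`, so that no measurability of `E` is needed. -/
theorem measureReal_mul_le_prod {Ω Ω' : Type*} [MeasurableSpace Ω] [MeasurableSpace Ω']
    (μ : Measure Ω) (ρ : Measure Ω') [IsProbabilityMeasure μ] [IsProbabilityMeasure ρ]
    {A : Set Ω} (hA : MeasurableSet A) (E : Set (Ω × Ω')) {q : ℝ}
    (h : ∀ s ∈ A, q ≤ ρ.real (Prod.mk s ⁻¹' E)) :
    μ.real A * q ≤ (μ.prod ρ).real E := by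
  have h1 : μ A * ENNReal.ofReal q ≤ (μ.prod ρ) E := by
    rw [← measure_toMeasurable E, Measure.prod_apply (measurableSet_toMeasurable _ _), mul_comm,
      ← setLIntegral_const]
    refine (setLIntegral_mono' hA fun s hs => ?_).trans (setLIntegral_le_lintegral A _)
    refine le_trans ?_ (measure_mono (Set.preimage_mono (subset_toMeasurable _ _)))
    rw [← ofReal_measureReal]
    exact ENNReal.ofReal_le_ofReal (h s hs)
  rw [measureReal_def, measureReal_def]
  rcases le_total q 0 with hq | hq
  · exact (mul_nonpos_of_nonneg_of_nonpos ENNReal.toReal_nonneg hq).trans ENNReal.toReal_nonneg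
  · have := ENNReal.toReal_mono (measure_ne_top _ _) h1
    rwa [ENNReal.toReal_mul, ENNReal.toReal_ofReal hq] at this

variable {d : ℕ} {ν : Measure ℝ} [IsProbabilityMeasure ν]

theorem mul_le_prob (hd : 1 ≤ d) {A : Set (ℕ → Fin d → ℤ)} (hA : MeasurableSet A) {n : ℕ}
    {u q : ℝ}
    (h : ∀ s ∈ A, q ≤ (Measure.infinitePi fun _ : Fin d → ℤ => ν).real
      {η | u ≤ ∑ k ∈ Finset.range (n + 1), η (position s k)}) :
    (Measure.infinitePi fun _ : ℕ => stepLaw d).real A * q ≤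
      (prob d ν).real {ω | u ≤ rwrs ω n} :=
  have := isProbabilityMeasure_stepLaw hd
  measureReal_mul_le_prod _ _ hA _ h

/-- The steps of the path which oscillates between the origin and a neighbour. -/
def oscillation (i : Fin d) (j : ℕ) : Fin d → ℤ := unitStep (i, j % 2 == 0)

theorem position_oscillation (i : Fin d) (j : ℕ) : position (oscillation i) (2 * j) = 0 := by
  induction j with
  | zero => rfl
  | succ j ih =>
    have h : 2 * (j + 1) = 2 * j + 1 + 1 := by ring
    rw [position, h, Finset.sum_range_succ, Finset.sum_range_succ, ← position, ih]
    ext l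
    simp [oscillation, unitStep, Nat.add_mod, Pi.single_apply]
    split_ifs <;> simp

theorem measureReal_oscillation (hd : 1 ≤ d) (i : Fin d) (m : ℕ) :
    (Measure.infinitePi fun _ : ℕ => stepLaw d).real
      (((Finset.range m : Finset ℕ) : Set ℕ).pi fun j => {oscillation i j}) =
      (1 / (2 * d)) ^ m := by
  have := isProbabilityMeasure_stepLaw hd
  rw [measureReal_def, Measure.infinitePi_pi _ fun _ _ => measurableSet_singleton _,
    ENNReal.toReal_prod]
  have h : ∀ j, ((stepLaw d) {oscillation i j}).toReal = 1 / (2 * d) := fun j =>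
    stepLaw_real_singleton _
  simp [h]

/-- Only the first $m$ steps are prescribed; a high value at the origin is collected at every even
time, and the other sites cost $1/2$. -/
theorem oscillation_lower_bound (hd : 1 ≤ d) (hν : MeasurePreserving Neg.neg ν ν) {m n : ℕ}
    (hmn : m ≤ n) {u t : ℝ} (ht : 0 ≤ t) (hu : u ≤ t * ((m + 1) / 2)) :
    (1 / (2 * d)) ^ m * (1 / 2 * ν.real (Set.Ici t)) ≤ (prob d ν).real {ω | u ≤ rwrs ω n} := by
  rw [← measureReal_oscillation hd ⟨0, hd⟩ m]
  refine mul_le_prob hd (MeasurableSet.pi (Finset.countable_toSet _)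
    fun _ _ => measurableSet_singleton _) fun s hs => ?_
  have hpos : ∀ k ≤ m, position s k = position (oscillation ⟨0, hd⟩) k := fun k hk =>
    Finset.sum_congr rfl fun j hj => by
      rw [Finset.mem_range] at hj
      exact hs j (by simpa using hj.trans_le hk)
  have hL : ({0} : Finset (Fin d → ℤ)) ⊆ (Finset.range (n + 1)).image (position s) := by
    rw [Finset.singleton_subset_iff]
    exact Finset.mem_image.mpr ⟨0, by simp, rfl⟩
  have hl := (half_le_localTime (g := position s) (x := 0) (m := m) fun j hj => by
    rw [hpos _ hj, position_oscillation]).trans (localTime_mono (position s) hmn 0)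
  have := half_mul_pow_le_of_sites hν (position s) hL (s := u) (t := t) (by
    rw [Finset.sum_singleton]
    exact hu.trans (mul_le_mul_of_nonneg_left hl ht))
  simpa using this

/-- The confined walk visits at most $(2R)^d$ sites, which carry local time at least $m+1$; all of
them are raised to level $t$. -/
theorem confinement_lower_bound (hd : 1 ≤ d) (hν : MeasurePreserving Neg.neg ν ν) {m n R : ℕ}
    (hmn : m ≤ n) (hR : 2 ≤ R) {u t : ℝ} (ht : 0 ≤ t) (hu : u ≤ t * (m + 1)) :
    Real.exp (-(3 * m / R ^ 2)) * (1 / 2 * ν.real (Set.Ici t) ^ (2 * R) ^ d) ≤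
      (prob d ν).real {ω | u ≤ rwrs ω n} := by
  refine (mul_le_mul_of_nonneg_right (exp_le_measureReal_confined hd hR m) (by positivity)).trans
    (mul_le_prob hd (measurableSet_confined R m 0) fun s hs => ?_)
  have hsub : (Finset.range (m + 1)).image (position s) ⊆
      (Finset.range (n + 1)).image (position s) :=
    Finset.image_subset_image (Finset.range_subset_range.mpr (by omega))
  have hcard : ((Finset.range (m + 1)).image (position s)).card ≤ (2 * R) ^ d := by
    have hbox : (Finset.range (m + 1)).image (position s) ⊆
        Fintype.piFinset fun _ : Fin d => Finset.Ico (-R : ℤ) R := fun x hx => by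
      obtain ⟨k, hk, rfl⟩ := Finset.mem_image.mp hx
      refine Fintype.mem_piFinset.mpr fun i => ?_
      have := hs k (by simpa [Nat.lt_succ_iff] using hk) i
      rw [zero_add, abs_lt] at this
      exact Finset.mem_Ico.mpr ⟨this.1.le, this.2⟩
    refine (Finset.card_le_card hbox).trans_eq ?_
    simp only [Fintype.card_piFinset, Int.card_Ico, Finset.prod_const, Finset.card_univ,
      Fintype.card_fin]
    congr 1
    omega
  have := half_mul_pow_le_of_sites hν (position s) hsub (s := u) (t := t) (by
    refine hu.trans (mul_le_mul_of_nonneg_left ?_ ht)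
    rw [← sum_localTime (position s) m]
    exact Finset.sum_le_sum fun x _ => localTime_mono _ hmn x)
  refine le_trans ?_ this
  exact mul_le_mul_of_nonneg_left
    (pow_le_pow_of_le_one measureReal_nonneg measureReal_le_one hcard) (by norm_num)

end Averaged
-- The three strategies
section Regions

variable {d : ℕ} {ν : Measure ℝ} [IsProbabilityMeasure ν]

theorem moderate_lower_bound (hd : 1 ≤ d) (hν : MeasurePreserving Neg.neg ν ν)
    (hpos : ∀ t, 0 ≤ t → 0 < ν.real (Set.Ici t)) {β : ℝ} (hβ : 1 / 2 < β) (hβ1 : β ≤ 1) {y : ℝ}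
    (hy : 0 < y) :
    ∃ c : ℝ, 0 < c ∧ ∀ n : ℕ, 1 ≤ n → Real.exp (-c * (n : ℝ) ^ (2 * β - 1)) ≤
      (prob d ν).real {ω | (n : ℝ) ^ β * y ≤ rwrs ω n} := by
  have := isProbabilityMeasure_stepLaw hd
  obtain ⟨c, hc, h⟩ := exists_exp_le_path (Fin d → ℤ) hν hpos hβ hβ1 hy
  refine ⟨c, hc, fun n hn => ?_⟩
  have h2 := mul_le_prob (ν := ν) hd MeasurableSet.univ (n := n) fun s _ => h n hn (position s)
  rwa [probReal_univ, one_mul] at h2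

theorem high_site_lower_bound (hd : 1 ≤ d) (hν : MeasurePreserving Neg.neg ν ν) {α C : ℝ}
    (hα : 0 < α) (hC : 0 < C)
    (htail : ∀ t : ℝ, 0 ≤ t → Real.exp (-C * (1 + t ^ α)) ≤ ν.real (Set.Ici t)) {β : ℝ}
    (hβ : 0 ≤ β) (hβ1 : β ≤ 1 + 1 / α) {y : ℝ} (hy : 0 < y) :
    ∃ c : ℝ, 0 < c ∧ ∀ n : ℕ, 1 ≤ n → Real.exp (-c * (n : ℝ) ^ (β * α / (α + 1))) ≤
      (prob d ν).real {ω | (n : ℝ) ^ β * y ≤ rwrs ω n} := by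
  have hd' : (1 : ℝ) ≤ d := by exact_mod_cast hd
  set w : ℝ := 1 / (2 * d) with hw
  have hw0 : 0 < w := by positivity
  have hw1 : w ≤ 1 := by
    rw [hw, div_le_one (by positivity)]
    linarith
  have hlog : 0 ≤ -Real.log w := neg_nonneg.mpr (Real.log_nonpos hw0.le hw1)
  have hyα : 0 < (2 * y) ^ α := by positivity
  refine ⟨(1 + 1 * -Real.log w) + C * (1 + (2 * y) ^ α), by positivity, fun n hn => ?_⟩
  have hn1 : (1 : ℝ) ≤ n := by exact_mod_cast hn
  have hn0 : (0 : ℝ) < n := by linarith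
  set γ := β * α / (α + 1) with hγ
  have hγ0 : 0 ≤ γ := by positivity
  have hγ1 : γ ≤ 1 := by
    rw [hγ, div_le_one (by positivity)]
    calc β * α ≤ (1 + 1 / α) * α := by gcongr
      _ = α + 1 := by field_simp
  set X := (n : ℝ) ^ γ with hX
  have hX1 : 1 ≤ X := Real.one_le_rpow hn1 hγ0
  have hXn : X ≤ n := by simpa using Real.rpow_le_rpow_of_exponent_le hn1 hγ1
  set t := 2 * y * (n : ℝ) ^ (β - γ) with ht
  have ht0 : 0 ≤ t := by positivity
  -- The balance of the two costs: $(\beta-\gamma)\alpha=\gamma$.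
  have htα : t ^ α = (2 * y) ^ α * X := by
    rw [ht, Real.mul_rpow (by positivity) (by positivity), ← Real.rpow_mul hn0.le, hX]
    congr 2
    rw [hγ]
    field_simp
    ring
  have hq : Real.exp (-(C * (1 + (2 * y) ^ α)) * X) ≤ ν.real (Set.Ici t) := by
    refine le_trans (Real.exp_le_exp.mpr ?_) (htail t ht0)
    rw [htα]
    nlinarith
  have hmX : (⌊X⌋₊ : ℝ) ≤ 1 * X := by
    rw [one_mul]
    exact Nat.floor_le (by linarith)
  have hu : (n : ℝ) ^ β * y ≤ t * ((⌊X⌋₊ + 1) / 2) := by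
    have h1 : X ≤ ⌊X⌋₊ + 1 := (Nat.lt_floor_add_one X).le
    calc (n : ℝ) ^ β * y = t * (X / 2) := by
          rw [ht, hX, show (n : ℝ) ^ β = (n : ℝ) ^ (β - γ) * (n : ℝ) ^ γ by
            rw [← Real.rpow_add hn0, sub_add_cancel]]
          ring
      _ ≤ _ := by gcongr
  refine le_trans ?_ (oscillation_lower_bound hd hν (Nat.floor_le_of_le hXn) ht0 hu)
  calc _ = Real.exp (-(1 + 1 * -Real.log w) * X) * Real.exp (-(C * (1 + (2 * y) ^ α)) * X) := by
        rw [← Real.exp_add]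
        congr 1
        ring
    _ ≤ 1 / 2 * w ^ ⌊X⌋₊ * ν.real (Set.Ici t) :=
        mul_le_mul (exp_le_half_mul_pow hw0 hw1 hX1 hmX) hq (Real.exp_pos _).le (by positivity)
    _ = _ := by ring

theorem localized_lower_bound (hd : 1 ≤ d) (hν : MeasurePreserving Neg.neg ν ν)
    (hpos : ∀ t, 0 ≤ t → 0 < ν.real (Set.Ici t)) {β : ℝ} (hβ : 0 ≤ β) (hβ1 : β ≤ 1) {y : ℝ}
    (hy : 0 < y) :
    ∃ c : ℝ, 0 < c ∧ ∀ n : ℕ, 1 ≤ n →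
      Real.exp (-c * (n : ℝ) ^ (β * ((d : ℝ) / ((d : ℝ) + 2)))) ≤
      (prob d ν).real {ω | (n : ℝ) ^ β * y ≤ rwrs ω n} := by
  set q := ν.real (Set.Ici y) with hq
  have hq0 : 0 < q := hpos y hy.le
  have hq1 : q ≤ 1 := measureReal_le_one
  have hlog : 0 ≤ -Real.log q := neg_nonneg.mpr (Real.log_nonpos hq0.le hq1)
  refine ⟨3 + (1 + 6 ^ d * -Real.log q), by positivity, fun n hn => ?_⟩
  have hn1 : (1 : ℝ) ≤ n := by exact_mod_cast hn
  have hn0 : (0 : ℝ) < n := by linarith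
  set Z := (n : ℝ) ^ (β / ((d : ℝ) + 2)) with hZ
  set X := (n : ℝ) ^ (β * ((d : ℝ) / ((d : ℝ) + 2))) with hX
  have hZ1 : 1 ≤ Z := Real.one_le_rpow hn1 (by positivity)
  have hX1 : 1 ≤ X := Real.one_le_rpow hn1 (by positivity)
  have hZX : Z ^ d = X := by
    rw [hZ, hX, ← Real.rpow_natCast, ← Real.rpow_mul hn0.le]
    congr 1
    ring
  have hZn : X * Z ^ 2 = (n : ℝ) ^ β := by
    rw [← hZX, ← pow_add, hZ, ← Real.rpow_natCast, ← Real.rpow_mul hn0.le]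
    congr 1
    push_cast
    field_simp
  have hnβ : (n : ℝ) ^ β ≤ n := by simpa using Real.rpow_le_rpow_of_exponent_le hn1 hβ1
  -- The added $1$ keeps the radius at least $2$ even when $Z=1$, as the confinement estimate
  -- requires.
  have hR : 2 ≤ ⌈Z⌉₊ + 1 := by
    have : 0 < ⌈Z⌉₊ := Nat.ceil_pos.mpr (by linarith)
    omega
  have hRZ : Z ≤ (⌈Z⌉₊ + 1 : ℕ) := by
    push_cast
    linarith [Nat.le_ceil Z]
  have hR3 : ((⌈Z⌉₊ + 1 : ℕ) : ℝ) ≤ 3 * Z := by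
    push_cast
    linarith [Nat.ceil_lt_add_one (show 0 ≤ Z by linarith)]
  have hm : (⌊(n : ℝ) ^ β⌋₊ : ℝ) ≤ X * Z ^ 2 := by
    rw [hZn]
    exact Nat.floor_le (by positivity)
  have hu : (n : ℝ) ^ β * y ≤ y * (⌊(n : ℝ) ^ β⌋₊ + 1) := by
    rw [mul_comm]
    exact mul_le_mul_of_nonneg_left (Nat.lt_floor_add_one _).le hy.le
  refine le_trans ?_ (confinement_lower_bound hd hν (Nat.floor_le_of_le hnβ) hR hy.le hu)
  have hcard : (((2 * (⌈Z⌉₊ + 1)) ^ d : ℕ) : ℝ) ≤ 6 ^ d * X := by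
    rw [← hZX, ← mul_pow, Nat.cast_pow]
    refine pow_le_pow_left₀ (Nat.cast_nonneg _) ?_ d
    rw [Nat.cast_mul, Nat.cast_ofNat]
    linarith
  have hexp : 3 * (⌊(n : ℝ) ^ β⌋₊ : ℝ) / ((⌈Z⌉₊ + 1 : ℕ) : ℝ) ^ 2 ≤ 3 * X := by
    rw [div_le_iff₀ (by positivity)]
    calc 3 * (⌊(n : ℝ) ^ β⌋₊ : ℝ) ≤ 3 * (X * Z ^ 2) := by gcongr
      _ = 3 * X * Z ^ 2 := by ring
      _ ≤ _ := by gcongr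
  calc _ = Real.exp (-(3 * X)) * Real.exp (-(1 + 6 ^ d * -Real.log q) * X) := by
        rw [← Real.exp_add]
        congr 1
        ring
    _ ≤ _ := mul_le_mul (Real.exp_le_exp.mpr (neg_le_neg hexp))
        (exp_le_half_mul_pow hq0 hq1 hX1 hcard) (Real.exp_pos _).le (Real.exp_pos _).le

end Regions
end RWRS

theorem proposition1p2
    (d : ℕ) (hd : 3 ≤ d)
    (ν : Measure ℝ) [IsProbabilityMeasure ν] (hbell : RWRS.IsBellShaped ν)
    (α κ : ℝ) (hα : 0 < α) (hκ : 0 < κ) (htail : RWRS.HasTailExponent ν α κ)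
    (β : ℝ) :
    (1 / 2 < β → β ≤ 1 → ∀ y : ℝ, 0 < y → ∃ c : ℝ, 0 < c ∧ ∀ n : ℕ, 1 ≤ n →
      Real.exp (-c * (n : ℝ) ^ (2 * β - 1)) ≤
        (RWRS.prob d ν).real {ω | (n : ℝ) ^ β * y ≤ RWRS.rwrs ω n}) ∧
    (0 ≤ β → β ≤ 1 + 1 / α → ∀ y : ℝ, 0 < y → ∃ c : ℝ, 0 < c ∧ ∀ n : ℕ, 1 ≤ n →
      Real.exp (-c * (n : ℝ) ^ (β * α / (α + 1))) ≤
        (RWRS.prob d ν).real {ω | (n : ℝ) ^ β * y ≤ RWRS.rwrs ω n}) ∧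
    (0 ≤ β → β ≤ 1 → ∀ y : ℝ, 0 < y → ∃ c : ℝ, 0 < c ∧ ∀ n : ℕ, 1 ≤ n →
      Real.exp (-c * (n : ℝ) ^ (β * ((d : ℝ) / ((d : ℝ) + 2)))) ≤
        (RWRS.prob d ν).real {ω | (n : ℝ) ^ β * y ≤ RWRS.rwrs ω n}) := by
  have hd1 : 1 ≤ d := by omega
  have hν := hbell.measurePreserving_neg
  obtain ⟨C, hC, hexp⟩ := htail.exists_exp_le hκ
  have hpos : ∀ t, 0 ≤ t → 0 < ν.real (Set.Ici t) := fun t ht =>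
    (Real.exp_pos _).trans_le (hexp t ht)
  exact ⟨fun hβ hβ1 y hy => RWRS.moderate_lower_bound hd1 hν hpos hβ hβ1 hy,
    fun hβ hβ1 y hy => RWRS.high_site_lower_bound hd1 hν hα hC hexp hβ hβ1 hy,
    fun hβ hβ1 y hy => RWRS.localized_lower_bound hd1 hν hpos hβ hβ1 hy⟩
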